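/- **Proposition 2.8 (O(3) purification, unlabeled).** Let $r_{\rm cut}>0$ and $\Omega=[0,r_{\rm cut}]\times\mathbb S^2$. Let $(R_n)_{n\in\mathbb N_0}$ be polynomials with (real or complex coefficients and) $\deg R_n=n$ for every $n$, and let $Y_l^m$ be the standard complex spherical harmonics. For a multi-index $k=(n,l,m)$ with $n,l\in\mathbb N_0$, $m\in\mathbb Z$, $|m|\le l$, put $$\phi_{k}(r,\hat{\mathbf r})=\phi_{nlm}(r,\hat{\mathbf r})=R_n(r)\,Y_l^m(\hat{\mathbf r}),\qquad (r,\hat{\mathbf r})\in\Omega .$$ For a tuple $\mathbf k=(k_1,\dots,k_N)$ of multi-indices and a finite multiset $\mathbf X=\{\!\{\mathbf x_1,\dots,\mathbf x_J\}\!\}$ on $\Omega$ (of any size $J$) define $$\mathcal A_{\mathbf k}(\mathbf X)=\sum_{\substack{j_1,\dots,j_N\in\{1,\dots,J\}\\ \text{pairwise distinct}}}\ \prod_{t=1}^N\phi_{k_t}(\mathbf x_{j_t}),\qquad \mathbf A_{\mathbf k}(\mathbf X)=\prod_{t=1}^N\sum_{j=1}^J\phi_{k_t}(\mathbf x_j).$$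 Fix any total order on the multi-indices (for instance the lexicographic one) and $D,\mathcal N\in\mathbb N_0$, and let $\mathbf K$ be the finite set of ordered tuples $\mathbf k=(k_1\le\dots\le k_N)$, $k_t=(n_t,l_t,m_t)$, with $$0\le N\le\mathcal N,\qquad \sum_t (n_t+l_t)\le D,\qquad \sum_t m_t=0,\qquad \sum_t l_t \text{ even}.$$ Then for each $\mathbf k\in\mathbf K$ the function $\mathcal A_{\mathbf k}$ can be written in exactly one way as a linear combination, with complex coefficients, of the functions $\mathbf A_{\mathbf k'}$, $\mathbf k'\in\mathbf K$, on the set of all finite multisets on $\Omega$. That is, there is exactly one matrix $\mathcal P=(\mathcal P^{\mathbf k}_{\mathbf k'})_{\mathbf k,\mathbf k'\in\mathbf K}$ with $$\mathcal A_{\mathbf k}(\mathbf X)=\sum_{\mathbf k'\in\mathbf K}\mathcal P^{\mathbf k}_{\mathbf k'}\,\mathbf A_{\mathbf k'}(\mathbf X)\qquad\text{for all }\mathbf k\in\mathbf K\text{ and all }\mathbf X,$$ and this matrix is invertible. -/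

import Mathlib

open scoped Polynomial BigOperators

noncomputable section

namespace Purification

/-- The unit sphere `𝕊²` of Euclidean three-space. -/
abbrev Sphere2 : Type := Metric.sphere (0 : EuclideanSpace ℝ (Fin 3)) 1

/-- The one-particle domain `Ω = [0, r_cut] × 𝕊²`: a radius and a direction. -/
abbrev Omega (rcut : ℝ) : Type := Set.Icc (0 : ℝ) rcut × Sphere2

/-- The Legendre polynomial `P_l = 1 / (2^l l!) (d/dz)^l (z² - 1)^l` (Rodrigues' formula). -/
def legendre (l : ℕ) : ℝ[X] :=
  Polynomial.C (1 / (2 ^ l * (l.factorial : ℝ))) *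
    (Polynomial.derivative^[l]) ((Polynomial.X ^ 2 - 1) ^ l)

/-- The spherical harmonic `Y_l^m` for `0 ≤ m ≤ l`, at the unit vector `u = (x, y, z)`:
`(-1)^m √((2l+1)/(4π) · (l-m)!/(l+m)!) · P_l^{(m)}(z) · (x + i y)^m`.
In polar coordinates `(x + i y)^m = (sin θ)^m e^{imφ}` and `z = cos θ`, so this is the usual
`√((2l+1)/(4π) · (l-m)!/(l+m)!) P_l^m(cos θ) e^{imφ}`, where
`P_l^m(z) = (-1)^m (1-z²)^{m/2} (d/dz)^m P_l(z)` is the associated Legendre function with the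
Condon-Shortley phase. -/
def sphHarmNonneg (l m : ℕ) (u : Sphere2) : ℂ :=
  (-1) ^ m *
    ((Real.sqrt ((2 * (l : ℝ) + 1) / (4 * Real.pi) *
      (((l - m).factorial : ℝ) / ((l + m).factorial : ℝ))) : ℝ) : ℂ) *
    ((((Polynomial.derivative^[m]) (legendre l)).eval (u.1 2) : ℝ) : ℂ) *
    (((u.1 0 : ℝ) : ℂ) + Complex.I * ((u.1 1 : ℝ) : ℂ)) ^ m

/-- The standard complex spherical harmonic `Y_l^m`, `-l ≤ m ≤ l`, with
`Y_l^{-m} = (-1)^m conj (Y_l^m)`. -/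
def sphHarm (l : ℕ) (m : ℤ) (u : Sphere2) : ℂ :=
  if 0 ≤ m then sphHarmNonneg l m.natAbs u
  else (-1) ^ m.natAbs * (starRingEnd ℂ) (sphHarmNonneg l m.natAbs u)

/-- The one-particle multi-indices `k = (n, l, m)` with `n, l ∈ ℕ₀` and `-l ≤ m ≤ l`. -/
@[ext]
structure Index where
  n : ℕ
  l : ℕ
  m : ℤ
  abs_le : |m| ≤ (l : ℤ)

/-- The one-particle function `φ_{nlm}(r, r̂) = R_n(r) Y_l^m(r̂)`. -/
def phi {rcut : ℝ} (R : ℕ → ℂ[X]) (k : Index) (x : Omega rcut) : ℂ :=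
  (R k.n).eval (((x.1 : ℝ)) : ℂ) * sphHarm k.l k.m x.2

/-- The pooled feature `A_k(X) = ∑_j φ_k(x_j)` of a multiset `X = {{x_j}}`. -/
def pooled {rcut : ℝ} (R : ℕ → ℂ[X]) (k : Index) (X : Multiset (Omega rcut)) : ℂ :=
  (X.map (phi R k)).sum

/-- The self-interacting basis function
`𝐀_{(k₁,…,k_N)}(X) = ∏_t A_{k_t}(X) = ∏_t ∑_j φ_{k_t}(x_j)`. -/
def selfInteracting {rcut : ℝ} (R : ℕ → ℂ[X]) (k : List Index)
    (X : Multiset (Omega rcut)) : ℂ :=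
  (k.map fun a => pooled R a X).prod

open Classical in
/-- The canonical basis function
`𝒜_{(k₁,…,k_N)}(X) = ∑_{j₁ ≠ ⋯ ≠ j_N} ∏_t φ_{k_t}(x_{j_t})`, the sum being over all choices of
`N` pairwise distinct members of the multiset `X`. The type attached to `X` has one term for each
member of `X` counted with multiplicity, so equal particles at different places count as
distinct members. -/
def canonical {rcut : ℝ} (R : ℕ → ℂ[X]) (k : List Index)
    (X : Multiset (Omega rcut)) : ℂ :=
  ∑ j : Fin k.length ↪ X, ∏ t : Fin k.length, phi R (k.get t) (j t).1

open Classical in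
/-- For a labelled family `x₁, …, x_J`, the canonical basis function is the sum over the injective
choices of labels. -/
theorem canonical_family {rcut : ℝ} (R : ℕ → ℂ[X]) (k : List Index) {J : ℕ}
    (x : Fin J → Omega rcut) :
    canonical R k (Multiset.map x Finset.univ.val) =
      ∑ j : Fin k.length ↪ Fin J, ∏ t : Fin k.length, phi R (k.get t) (x (j t)) := by
  have hbij : Function.Bijective
      (fun v : (Finset.univ : Finset (Fin J)).val.ToType => (v.1 : Fin J)) := by
    constructor
    · rintro ⟨a, i⟩ ⟨b, j⟩ h
      have h' : a = b := h
      subst h'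
      have h1 : Multiset.count a (Finset.univ : Finset (Fin J)).val = 1 :=
        Multiset.count_eq_one_of_mem Finset.univ.nodup (Finset.mem_univ a)
      have h2 : i = j := by
        apply Fin.ext
        have := i.2
        have := j.2
        omega
      rw [h2]
    · intro a
      exact ⟨⟨a, ⟨0, Multiset.count_pos.2 (Finset.mem_univ a)⟩⟩, rfl⟩
  let e := (Equiv.ofBijective _ hbij).symm.trans
    (Multiset.mapEquiv (Finset.univ : Finset (Fin J)).val x)
  have he : ∀ i, (e i).1 = x i := by
    intro i
    have h1 := Multiset.mapEquiv_apply (Finset.univ : Finset (Fin J)).val x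
      ((Equiv.ofBijective _ hbij).symm i)
    have h2 : ((Equiv.ofBijective _ hbij).symm i).1 = i :=
      (Equiv.ofBijective _ hbij).apply_symm_apply i
    rw [h2] at h1
    exact h1
  unfold canonical
  symm
  refine Fintype.sum_equiv (Equiv.embeddingCongr (Equiv.refl _) e) _ _ ?_
  intro j
  refine Finset.prod_congr rfl fun t _ => ?_
  simp [Equiv.embeddingCongr, he]

/-- `deg(𝐤) = ∑_t (n_t + l_t)`. -/
def deg (k : List Index) : ℕ := (k.map fun a => a.n + a.l).sum

/-- The index set `𝐊`: the ordered tuples `𝐤 = (k₁ ≤ ⋯ ≤ k_N)` of order `0 ≤ N ≤ 𝒩` and total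
degree at most `D` for which `∑ m_t = 0` and `∑ l_t` is even. -/
def indexSet [LinearOrder Index] (D maxOrd : ℕ) : Set (List Index) :=
  {k | k.Pairwise (· ≤ ·) ∧ k.length ≤ maxOrd ∧ deg k ≤ D ∧
    (k.map Index.m).sum = 0 ∧ Even (k.map Index.l).sum}

theorem indexSet_finite [LinearOrder Index] (D maxOrd : ℕ) : (indexSet D maxOrd).Finite := by
  let S : Set Index := {a | a.n + a.l ≤ D}
  have hS : S.Finite := by
    have hfin : (Set.Iic D ×ˢ Set.Iic D ×ˢ Set.Icc (-(D : ℤ)) (D : ℤ)).Finite :=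
      (Set.finite_Iic D).prod ((Set.finite_Iic D).prod (Set.finite_Icc _ _))
    refine Set.Finite.of_finite_image (f := fun a : Index => (a.n, a.l, a.m))
      (hfin.subset ?_) ?_
    · rintro _ ⟨a, ha, rfl⟩
      have ha' : a.n + a.l ≤ D := ha
      have := abs_le.1 a.abs_le
      simp only [Set.mem_prod, Set.mem_Iic, Set.mem_Icc]
      omega
    · intro a _ b _ h
      simp only [Prod.mk.injEq] at h
      exact Index.ext h.1 h.2.1 h.2.2
  have : Finite S := hS
  refine ((List.finite_length_le S maxOrd).image (List.map Subtype.val)).subset ?_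
  rintro k ⟨-, hlen, hdeg, -, -⟩
  have hmem : ∀ a ∈ k, a ∈ S := fun a ha =>
    le_trans (List.single_le_sum (by simp) _ (List.mem_map_of_mem ha)) hdeg
  refine ⟨k.attach.map fun a => ⟨a.1, hmem a.1 a.2⟩, by simpa using hlen, ?_⟩
  simp [List.map_map, Function.comp_def]

instance [LinearOrder Index] (D maxOrd : ℕ) : Fintype (indexSet D maxOrd) :=
  (indexSet_finite D maxOrd).fintype

end Purification

end

open scoped Polynomial BigOperators

noncomputable section

namespace Purification

/-! Existence. In a sum over pairwise distinct particles, let the first particle run freely and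
subtract its collisions with the others. The free part is a pooled feature times a shorter canonical
function; a collision multiplies two one-particle functions at the same particle
(`distinctSum_cons`). Such a product is again a combination of one-particle functions: degrees do
not grow, `m` adds, and the parity of `l` adds (`phi_mul_phi_mem_span`). By induction, each
canonical function is the self-interacting function of the same tuple plus a combination of strictly
shorter ones, and all constraints defining the index set survive (`distinctSum_sub_mem_lowerSpan`).
The transformation is thus unitriangular in the tuple length, so the two families span each other.

Uniqueness. The one-particle functions are linearly independent, so their value vectors on any
finite set of indices span the whole coordinate space. Sums of these vectors over multisets are then
Zariski dense (`mvPolynomial_eq_zero_of_sums`). Hence the pooled features are algebraically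
independent, and the self-interacting functions, being distinct monomials in them, are linearly
independent. -/

/-! ### Polynomials with controlled support -/

/-- If the `q i`, `i ∈ s`, have degree exactly `i` and support in `s`, they span the polynomials
with support in `s`, degree by degree. -/
theorem mem_span_of_triangular {q : ℕ → ℂ[X]} {s : Set ℕ}
    (hlead : ∀ i ∈ s, (q i).coeff i ≠ 0)
    (hsupp : ∀ i ∈ s, ∀ j, (q i).coeff j ≠ 0 → j ∈ s ∧ j ≤ i) (N : ℕ) (p : ℂ[X])
    (hp : ∀ j, p.coeff j ≠ 0 → j ∈ s ∧ j < N) :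
    p ∈ Submodule.span ℂ (q '' {i | i ∈ s ∧ i < N}) := by
  induction N generalizing p with
  | zero =>
    have : p = 0 := by
      ext j
      by_contra h
      exact absurd (hp j h).2 (Nat.not_lt_zero j)
    rw [this]
    exact Submodule.zero_mem _
  | succ N ih =>
    have hmono : Submodule.span ℂ (q '' {i | i ∈ s ∧ i < N}) ≤
        Submodule.span ℂ (q '' {i | i ∈ s ∧ i < N + 1}) :=
      Submodule.span_mono (Set.image_mono fun i hi => ⟨hi.1, hi.2.trans (Nat.lt_succ_self N)⟩)
    by_cases hN : N ∈ s
    · set c : ℂ := p.coeff N / (q N).coeff N with hc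
      have hr : p - c • q N ∈ Submodule.span ℂ (q '' {i | i ∈ s ∧ i < N}) := by
        refine ih _ fun j hj => ?_
        rw [Polynomial.coeff_sub, Polynomial.coeff_smul, smul_eq_mul] at hj
        have hjN : j ≠ N := by
          rintro rfl
          apply hj
          rw [hc, div_mul_cancel₀ _ (hlead _ hN), sub_self]
        by_cases h1 : p.coeff j = 0
        · have h2 : (q N).coeff j ≠ 0 := by
            intro h2
            simp [h1, h2] at hj
          have := hsupp N hN j h2
          exact ⟨this.1, lt_of_le_of_ne this.2 hjN⟩
        · have := hp j h1
          exact ⟨this.1, by omega⟩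
      have : p = (p - c • q N) + c • q N := by ring
      rw [this]
      exact Submodule.add_mem _ (hmono hr) (Submodule.smul_mem _ _
        (Submodule.subset_span ⟨N, ⟨hN, Nat.lt_succ_self N⟩, rfl⟩))
    · refine hmono (ih p fun j hj => ?_)
      have h := hp j hj
      refine ⟨h.1, lt_of_le_of_ne (Nat.lt_succ_iff.1 h.2) ?_⟩
      rintro rfl
      exact hN h.1

/-- `p` is a combination of the monomials `X ^ d, X ^ (d - 2), …`. -/
def HasParity {K : Type*} [Semiring K] (d : ℕ) (p : K[X]) : Prop :=
  ∀ j, p.coeff j ≠ 0 → ∃ i, j + 2 * i = d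

theorem HasParity.mul {K : Type*} [Semiring K] {d e : ℕ} {p q : K[X]}
    (hp : HasParity d p) (hq : HasParity e q) : HasParity (d + e) (p * q) := by
  intro j hj
  rw [Polynomial.coeff_mul] at hj
  obtain ⟨x, hx, hne⟩ := Finset.exists_ne_zero_of_sum_ne_zero hj
  obtain ⟨a, ha⟩ := hp x.1 (left_ne_zero_of_mul hne)
  obtain ⟨b, hb⟩ := hq x.2 (right_ne_zero_of_mul hne)
  rw [Finset.HasAntidiagonal.mem_antidiagonal] at hx
  exact ⟨a + b, by omega⟩

theorem HasParity.pow {K : Type*} [Semiring K] {d : ℕ} {p : K[X]}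
    (hp : HasParity d p) (n : ℕ) : HasParity (n * d) (p ^ n) := by
  induction n with
  | zero =>
    intro j hj
    rw [pow_zero, Polynomial.coeff_one] at hj
    exact ⟨0, by simp only [ne_eq, ite_eq_right_iff, not_forall] at hj; simp [hj.1]⟩
  | succ n ih =>
    rw [pow_succ, Nat.succ_mul]
    exact ih.mul hp

theorem hasParity_sq_sub_one {K : Type*} [Ring K] :
    HasParity 2 (Polynomial.X ^ 2 - 1 : K[X]) := by
  intro j hj
  rw [Polynomial.coeff_sub, Polynomial.coeff_X_pow, Polynomial.coeff_one] at hj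
  by_cases h2 : j = 2
  · exact ⟨0, by omega⟩
  · by_cases h0 : j = 0
    · exact ⟨1, by omega⟩
    · simp [h2, h0] at hj

theorem hasParity_one_sub_sq {K : Type*} [Ring K] :
    HasParity 2 (1 - Polynomial.X ^ 2 : K[X]) := by
  intro j hj
  refine hasParity_sq_sub_one (K := K) j fun h => hj ?_
  rw [← neg_sub, Polynomial.coeff_neg, h, neg_zero]

/-! ### Spherical harmonics as polynomials -/

/-- By Rodrigues' formula, differentiating `m` more times gives a multiple of the derivative of
order `m + l` of `(z² - 1)^l`; hence the index shift. -/
theorem coeff_derivative_legendre (l m j : ℕ) :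
    ((Polynomial.derivative^[m]) (legendre l)).coeff j =
      1 / (2 ^ l * (l.factorial : ℝ)) * (((j + (m + l)).descFactorial (m + l) : ℝ) *
        ((Polynomial.X ^ 2 - 1 : ℝ[X]) ^ l).coeff (j + (m + l))) := by
  rw [legendre, Polynomial.iterate_derivative_C_mul, ← Function.iterate_add_apply,
    Polynomial.coeff_C_mul, Polynomial.coeff_iterate_derivative, nsmul_eq_mul]

theorem coeff_derivative_legendre_ne_zero_imp {l m j : ℕ}
    (h : ((Polynomial.derivative^[m]) (legendre l)).coeff j ≠ 0) :
    ∃ i, j + m + 2 * i = l := by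
  rw [coeff_derivative_legendre] at h
  obtain ⟨i, hi⟩ := (hasParity_sq_sub_one (K := ℝ)).pow l _
    (right_ne_zero_of_mul (right_ne_zero_of_mul h))
  exact ⟨i, by omega⟩

theorem coeff_derivative_legendre_ne_zero {l m j : ℕ} (h : j + m = l) :
    ((Polynomial.derivative^[m]) (legendre l)).coeff j ≠ 0 := by
  have hmon : (Polynomial.X ^ 2 - 1 : ℝ[X]).Monic :=
    Polynomial.monic_X_pow_sub_C (1 : ℝ) two_ne_zero
  have hdeg : ((Polynomial.X ^ 2 - 1 : ℝ[X]) ^ l).natDegree = j + (m + l) := by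
    have : (Polynomial.X ^ 2 - 1 : ℝ[X]).natDegree = 2 :=
      Polynomial.natDegree_X_pow_sub_C (n := 2) (r := (1 : ℝ))
    rw [hmon.natDegree_pow, this]
    omega
  rw [coeff_derivative_legendre, ← hdeg, (hmon.pow l).coeff_natDegree, hdeg, mul_one]
  refine mul_ne_zero (by positivity) ?_
  rw [Nat.cast_ne_zero, Ne, Nat.descFactorial_eq_zero_iff_lt]
  omega

/-- The polynomial in `z` that multiplies the azimuthal factor in `Y_l^m`. -/
def polarPoly (l : ℕ) (m : ℤ) : ℂ[X] :=
  Polynomial.C ((if 0 ≤ m then (-1) ^ m.natAbs else 1) *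
    ((Real.sqrt ((2 * (l : ℝ) + 1) / (4 * Real.pi) *
      (((l - m.natAbs).factorial : ℝ) / ((l + m.natAbs).factorial : ℝ))) : ℝ) : ℂ)) *
    ((Polynomial.derivative^[m.natAbs]) (legendre l)).map Complex.ofRealHom

theorem coeff_polarPoly_ne_zero_imp {l : ℕ} {m : ℤ} {j : ℕ} (h : (polarPoly l m).coeff j ≠ 0) :
    ∃ i, j + m.natAbs + 2 * i = l := by
  rw [polarPoly, Polynomial.coeff_C_mul, Polynomial.coeff_map] at h
  refine coeff_derivative_legendre_ne_zero_imp fun h0 => right_ne_zero_of_mul h ?_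
  rw [h0, map_zero]

theorem coeff_polarPoly_ne_zero {l : ℕ} {m : ℤ} {j : ℕ} (h : j + m.natAbs = l) :
    (polarPoly l m).coeff j ≠ 0 := by
  rw [polarPoly, Polynomial.coeff_C_mul, Polynomial.coeff_map]
  refine mul_ne_zero (mul_ne_zero ?_ ?_) ?_
  · split_ifs
    · exact pow_ne_zero _ (by norm_num)
    · exact one_ne_zero
  · rw [Complex.ofReal_ne_zero]
    exact (Real.sqrt_pos.2 (by positivity)).ne'
  · exact Complex.ofReal_ne_zero.2 (coeff_derivative_legendre_ne_zero h)

/-- The azimuthal factor `(x + i y)^m`, or `(x - i y)^(-m)` for negative `m`. -/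
def azimuth (m : ℤ) (u : Sphere2) : ℂ :=
  (((u.1 0 : ℝ) : ℂ) + Complex.I * ((u.1 1 : ℝ) : ℂ)) ^ m.toNat *
    (((u.1 0 : ℝ) : ℂ) - Complex.I * ((u.1 1 : ℝ) : ℂ)) ^ (-m).toNat

theorem sphHarm_eq (l : ℕ) (m : ℤ) (u : Sphere2) :
    sphHarm l m u = (polarPoly l m).eval ((u.1 2 : ℝ) : ℂ) * azimuth m u := by
  have hev : (((Polynomial.derivative^[m.natAbs]) (legendre l)).map Complex.ofRealHom).eval
      ((u.1 2 : ℝ) : ℂ) =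
      ((((Polynomial.derivative^[m.natAbs]) (legendre l)).eval (u.1 2) : ℝ) : ℂ) :=
    Polynomial.eval_map_apply Complex.ofRealHom (u.1 2)
  unfold sphHarm sphHarmNonneg polarPoly azimuth
  rw [Polynomial.eval_mul, Polynomial.eval_C, hev]
  by_cases h : 0 ≤ m
  · have h1 : m.toNat = m.natAbs := by omega
    have h2 : (-m).toNat = 0 := by omega
    simp only [h, if_true, h1, h2, pow_zero, mul_one]
  · have h1 : m.toNat = 0 := by omega
    have h2 : (-m).toNat = m.natAbs := by omega
    -- The sign in `Y_l^{-m} = (-1)^m conj (Y_l^m)` cancels the Condon-Shortley phase, which is why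
    -- `polarPoly` carries no sign for negative `m`.
    have h3 : ((-1 : ℂ) ^ m.natAbs) * (-1) ^ m.natAbs = 1 := by
      rw [← mul_pow]; norm_num
    simp only [h, if_false, h1, h2, pow_zero, one_mul, map_mul, map_pow, map_neg, map_one,
      Complex.conj_ofReal, map_add, Complex.conj_I]
    rw [← mul_assoc, ← mul_assoc, ← mul_assoc, h3, one_mul, neg_mul, ← sub_eq_add_neg]

theorem sphere_sq_add_sq (u : Sphere2) :
    (((u.1 0 : ℝ) : ℂ) + Complex.I * ((u.1 1 : ℝ) : ℂ)) *
      (((u.1 0 : ℝ) : ℂ) - Complex.I * ((u.1 1 : ℝ) : ℂ)) = 1 - ((u.1 2 : ℝ) : ℂ) ^ 2 := by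
  have h1 : ‖u.1‖ = 1 := by simp
  have h2 : (u.1 0) ^ 2 + (u.1 1) ^ 2 + (u.1 2) ^ 2 = 1 := by
    have := EuclideanSpace.real_norm_sq_eq u.1
    rw [h1, Fin.sum_univ_three] at this
    linarith
  have h3 : ((u.1 0 : ℝ) : ℂ) ^ 2 + ((u.1 1 : ℝ) : ℂ) ^ 2 + ((u.1 2 : ℝ) : ℂ) ^ 2 = 1 := by
    simpa using congrArg (fun t : ℝ => (t : ℂ)) h2
  linear_combination h3 - ((u.1 1 : ℝ) : ℂ) ^ 2 * Complex.I_sq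

/-- When `m` and `m'` have opposite signs, `e` pairs `(x + i y)(x - i y)` collapse to `1 - z²` on
the sphere. Each pair is even in `z` and accounts for two units of azimuthal order, so the parity of
`l` is preserved. -/
theorem azimuth_mul (m m' : ℤ) : ∃ e : ℕ, 2 * e + (m + m').natAbs = m.natAbs + m'.natAbs ∧
    ∀ u, azimuth m u * azimuth m' u =
      ((1 - Polynomial.X ^ 2 : ℂ[X]) ^ e).eval ((u.1 2 : ℝ) : ℂ) * azimuth (m + m') u := by
  obtain ⟨e, he1, he2⟩ : ∃ e : ℕ, m.toNat + m'.toNat = (m + m').toNat + e ∧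
      (-m).toNat + (-m').toNat = (-(m + m')).toNat + e :=
    ⟨m.toNat + m'.toNat - (m + m').toNat, by omega, by omega⟩
  refine ⟨e, by omega, fun u => ?_⟩
  have : ((1 - Polynomial.X ^ 2 : ℂ[X]) ^ e).eval ((u.1 2 : ℝ) : ℂ) =
      (1 - ((u.1 2 : ℝ) : ℂ) ^ 2) ^ e := by simp
  rw [this, ← sphere_sq_add_sq, azimuth, azimuth, azimuth, mul_mul_mul_comm, ← pow_add, ← pow_add,
    he1, he2, pow_add, pow_add, mul_pow]
  ring

/-! ### Products of one-particle functions -/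

theorem coeff_ne_zero_of_degree {R : ℕ → ℂ[X]} (hR : ∀ n, (R n).degree = n) (n : ℕ) :
    (R n).coeff n ≠ 0 :=
  Polynomial.coeff_ne_zero_of_eq_degree (hR n)

theorem mul_mem_span_radial {R : ℕ → ℂ[X]} (hR : ∀ n, (R n).degree = n) (n n' : ℕ) :
    R n * R n' ∈ Submodule.span ℂ (R '' {i | i ≤ n + n'}) := by
  have hle : ∀ i j, (R i).coeff j ≠ 0 → j ≤ i := fun i j h => by
    have := Polynomial.le_natDegree_of_ne_zero h
    rwa [Polynomial.natDegree_eq_of_degree_eq_some (hR i)] at this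
  have := mem_span_of_triangular (q := R) (s := Set.univ)
    (fun i _ => coeff_ne_zero_of_degree hR i) (fun i _ j h => ⟨trivial, hle i j h⟩)
    (n + n' + 1) (R n * R n') (fun j hj => ⟨trivial, by
      have h := (Polynomial.le_natDegree_of_ne_zero hj).trans Polynomial.natDegree_mul_le
      rw [Polynomial.natDegree_eq_of_degree_eq_some (hR n),
        Polynomial.natDegree_eq_of_degree_eq_some (hR n')] at h
      omega⟩)
  refine Submodule.span_mono (Set.image_mono ?_) this
  rintro i ⟨-, hi⟩
  exact Nat.lt_succ_iff.1 hi

/-- The polynomial `polarPoly (i + |M|) M` has degree exactly `i` and only powers of the parity of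
`i`, so the triangular argument applies on the exponents `d, d - 2, …`. -/
theorem mem_span_polarPoly (M : ℤ) {d : ℕ} {p : ℂ[X]} (hp : HasParity d p) :
    p ∈ Submodule.span ℂ ((fun l => polarPoly l M) ''
      {l | M.natAbs ≤ l ∧ ∃ i, l + 2 * i = d + M.natAbs}) := by
  have := mem_span_of_triangular (q := fun i => polarPoly (i + M.natAbs) M)
    (s := {j | ∃ i, j + 2 * i = d})
    (fun i _ => coeff_polarPoly_ne_zero rfl)
    (fun i hi j h => by
      obtain ⟨a, ha⟩ := hi
      obtain ⟨b, hb⟩ := coeff_polarPoly_ne_zero_imp h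
      exact ⟨⟨a + b, by omega⟩, by omega⟩)
    (d + 1) p (fun j hj => by
      obtain ⟨a, ha⟩ := hp j hj
      exact ⟨⟨a, ha⟩, by omega⟩)
  refine Submodule.span_mono ?_ this
  rintro _ ⟨j, ⟨⟨i, hi⟩, -⟩, rfl⟩
  exact ⟨j + M.natAbs, ⟨by omega, i, by omega⟩, rfl⟩

/-- The product of two one-particle functions is a combination of one-particle functions of no
larger degree, of the same total `m` and the same parity of `l`. -/
theorem phi_mul_phi_mem_span {rcut : ℝ} {R : ℕ → ℂ[X]} (hR : ∀ n, (R n).degree = n)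
    (a b : Index) :
    (phi R a * phi R b : Omega rcut → ℂ) ∈ Submodule.span ℂ (phi R '' {c | c.n + c.l ≤
      a.n + a.l + (b.n + b.l) ∧ c.m = a.m + b.m ∧ ∃ i, c.l + 2 * i = a.l + b.l}) := by
  obtain ⟨e, he, haz⟩ := azimuth_mul a.m b.m
  -- With the azimuthal factor of the product fixed, the rest is bilinear in its radial and polar
  -- polynomials, so each can be expanded in its own basis.
  let B : ℂ[X] →ₗ[ℂ] ℂ[X] →ₗ[ℂ] (Omega rcut → ℂ) := LinearMap.mk₂ ℂ
    (fun p q x => p.eval (((x.1 : ℝ)) : ℂ) *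
      (q.eval ((x.2.1 2 : ℝ) : ℂ) * azimuth (a.m + b.m) x.2))
    (by intros; ext; simp [add_mul]) (by intros; ext; simp [mul_assoc])
    (by intros; ext; simp [add_mul, mul_add]) (by intros; ext; simp; ring)
  have hphi : (phi R a * phi R b : Omega rcut → ℂ) = B (R a.n * R b.n)
      (polarPoly a.l a.m * polarPoly b.l b.m * (1 - Polynomial.X ^ 2) ^ e) := by
    ext x
    change phi R a x * phi R b x = _ * (_ * _)
    rw [phi, phi, sphHarm_eq, sphHarm_eq, Polynomial.eval_mul, Polynomial.eval_mul,
      Polynomial.eval_mul, mul_assoc (_ * _) _ (azimuth (a.m + b.m) x.2), ← haz]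
    ring
  have ha : a.m.natAbs ≤ a.l := by have := abs_le.1 a.abs_le; omega
  have hb : b.m.natAbs ≤ b.l := by have := abs_le.1 b.abs_le; omega
  have hpol : HasParity (a.l + b.l - (a.m + b.m).natAbs)
      (polarPoly a.l a.m * polarPoly b.l b.m * (1 - Polynomial.X ^ 2) ^ e) := by
    have h1 : ∀ c : Index, HasParity (c.l - c.m.natAbs) (polarPoly c.l c.m) := fun c j hj => by
      obtain ⟨i, hi⟩ := coeff_polarPoly_ne_zero_imp hj
      exact ⟨i, by omega⟩
    -- The exponents add up because `2 e + |m_a + m_b| = |m_a| + |m_b|`.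
    have h2 := ((h1 a).mul (h1 b)).mul ((hasParity_one_sub_sq (K := ℂ)).pow e)
    convert h2 using 1
    omega
  rw [hphi]
  have hmem := Submodule.apply_mem_map₂ B (mul_mem_span_radial hR a.n b.n)
    (mem_span_polarPoly (a.m + b.m) hpol)
  rw [Submodule.map₂_span_span] at hmem
  refine Submodule.span_mono ?_ hmem
  rintro _ ⟨_, ⟨n, hn, rfl⟩, _, ⟨l, ⟨hl, i, hi⟩, rfl⟩, rfl⟩
  have hn' : n ≤ a.n + b.n := hn
  refine ⟨⟨n, l, a.m + b.m, abs_le.2 ⟨by omega, by omega⟩⟩, ⟨by simp only; omega, rfl, i, by simp only; omega⟩, ?_⟩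
  ext x
  change phi R _ x = _ * (_ * _)
  rw [phi, sphHarm_eq]

/-! ### The recursion for the canonical basis functions -/

/-- A sum over injective `(N + 1)`-tuples: choose the first entry freely and subtract the
collisions with the other entries. -/
theorem sum_embedding_cons {ι : Type*} [Fintype ι] [DecidableEq ι] {N : ℕ} (g : ι → ℂ)
    (f : Fin N → ι → ℂ) :
    ∑ j : Fin (N + 1) ↪ ι, ∏ t, (Fin.cons g f : Fin (N + 1) → ι → ℂ) t (j t) =
      (∑ a, g a) * ∑ j : Fin N ↪ ι, ∏ t, f t (j t) -
        ∑ s, ∑ j : Fin N ↪ ι, g (j s) * ∏ t, f t (j t) := by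
  have hcompl : ∀ j : Fin N ↪ ι, ∑ a : {a // a ∉ Set.range j}, g a =
      ∑ a, g a - ∑ s, g (j s) := by
    intro j
    rw [eq_sub_iff_add_eq, ← Finset.sum_map Finset.univ j g,
      ← Finset.sum_subtype (Finset.univ.map j)ᶜ (fun a => by simp) g, Finset.sum_compl_add_sum]
  rw [← (Equiv.embeddingFinSucc N ι).symm.sum_comp, Fintype.sum_sigma, Finset.mul_sum,
    Finset.sum_comm, ← Finset.sum_sub_distrib]
  refine Finset.sum_congr rfl fun j _ => ?_
  simp only [Fin.prod_univ_succ, Fin.cons_zero, Fin.cons_succ, Equiv.coe_embeddingFinSucc_symm]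
  rw [← Finset.sum_mul, hcompl, sub_mul, Finset.sum_mul, Finset.sum_mul]

open Classical in
/-- The sum over pairwise distinct members of a multiset, as a multilinear map of the
one-particle functions. -/
def distinctSum (E : Type*) [DecidableEq E] (N : ℕ) :
    MultilinearMap ℂ (fun _ : Fin N => E → ℂ) (Multiset E → ℂ) :=
  MultilinearMap.pi fun X => ∑ j : Fin N ↪ X,
    (MultilinearMap.mkPiAlgebra ℂ (Fin N) ℂ).compLinearMap fun t => LinearMap.proj (j t).1

open Classical in
theorem distinctSum_apply {E : Type*} [DecidableEq E] {N : ℕ} (f : Fin N → E → ℂ) (X : Multiset E) :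
    distinctSum E N f X = ∑ j : Fin N ↪ X, ∏ t, f t (j t).1 := by
  simp [distinctSum]

/-- If the free particle coincides with the one in slot `s`, then `g` and `f s` are evaluated at the
same particle and merge into `g * f s`. -/
theorem distinctSum_cons {E : Type*} [DecidableEq E] {N : ℕ} (g : E → ℂ) (f : Fin N → E → ℂ) :
    distinctSum E (N + 1) (Fin.cons g f) = (fun X => (X.map g).sum) * distinctSum E N f -
      ∑ s, distinctSum E N (Function.update f s (g * f s)) := by
  classical
  ext X
  have h := sum_embedding_cons (fun i : X => g i.1) (fun t (i : X) => f t i.1)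
  have hsum : ∑ i : X, g i.1 = (X.map g).sum := by
    rw [Finset.sum_eq_multiset_sum]
    exact congrArg Multiset.sum (Multiset.map_univ_comp_coe X g)
  rw [Pi.sub_apply, Pi.mul_apply, Finset.sum_apply, ← hsum, distinctSum_apply, distinctSum_apply]
  convert h using 2
  · refine Finset.prod_congr rfl fun t _ => ?_
    refine Fin.cases ?_ (fun t => ?_) t <;> simp
  · refine Finset.sum_congr rfl fun s _ => ?_
    rw [distinctSum_apply]
    refine Finset.sum_congr rfl fun j _ => ?_
    rw [← Finset.mul_prod_erase _
        (fun t => Function.update f s (g * f s) t (j t).1) (Finset.mem_univ s),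
      ← Finset.mul_prod_erase _ (fun t => f t (j t).1) (Finset.mem_univ s), ← mul_assoc]
    congr 1
    · simp
    · refine Finset.prod_congr rfl fun t ht => ?_
      rw [Function.update_of_ne (Finset.ne_of_mem_erase ht)]

/-! ### Expansion in self-interacting functions -/

/-- The self-interacting function of an unordered tuple. -/
def pooledProd {rcut : ℝ} (R : ℕ → ℂ[X]) (μ : Multiset Index) : Multiset (Omega rcut) → ℂ :=
  (μ.map fun a => (pooled R a : Multiset (Omega rcut) → ℂ)).prod

theorem pooledProd_cons {rcut : ℝ} (R : ℕ → ℂ[X]) (a : Index) (μ : Multiset Index) :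
    (pooledProd R (a ::ₘ μ) : Multiset (Omega rcut) → ℂ) = pooled R a * pooledProd R μ := by
  rw [pooledProd, Multiset.map_cons, Multiset.prod_cons, pooledProd]

/-- The tuples whose total degree is at most that of `ν`, with the same total `m` and the same
parity of the total `l`. -/
def Dominated (ν μ : Multiset Index) : Prop :=
  (μ.map fun a => a.n + a.l).sum ≤ (ν.map fun a => a.n + a.l).sum ∧
    (μ.map Index.m).sum = (ν.map Index.m).sum ∧
    ((μ.map Index.l).sum : ZMod 2) = ((ν.map Index.l).sum : ZMod 2)

/-- The functions spanned by self-interacting functions of order less than `N` that are dominated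
by `ν`. -/
def lowerSpan {rcut : ℝ} (R : ℕ → ℂ[X]) (N : ℕ) (ν : Multiset Index) :
    Submodule ℂ (Multiset (Omega rcut) → ℂ) :=
  Submodule.span ℂ (pooledProd R '' {μ | μ.card < N ∧ Dominated ν μ})

theorem lowerSpan_mono {rcut : ℝ} {R : ℕ → ℂ[X]} {N N' : ℕ} {ν ν' : Multiset Index}
    (hN : N ≤ N') (h : Dominated ν' ν) :
    (lowerSpan R N ν : Submodule ℂ (Multiset (Omega rcut) → ℂ)) ≤ lowerSpan R N' ν' :=
  Submodule.span_mono (Set.image_mono fun _ hμ => ⟨hμ.1.trans_le hN, hμ.2.1.trans h.1,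
    hμ.2.2.1.trans h.2.1, hμ.2.2.2.trans h.2.2⟩)

theorem Dominated.cons {ν μ : Multiset Index} (h : Dominated ν μ) (a : Index) :
    Dominated (a ::ₘ ν) (a ::ₘ μ) := by
  obtain ⟨h1, h2, h3⟩ := h
  simp only [Dominated, Multiset.map_cons, Multiset.sum_cons, Nat.cast_add]
  exact ⟨by omega, by omega, by rw [h3]⟩

/-- Keeping `k s` on the left avoids erasing from a multiset, and so avoids truncated subtraction
when degrees are compared. -/
theorem map_update_cons {N : ℕ} (k : Fin N → Index) (s : Fin N) (b : Index) :
    k s ::ₘ Finset.univ.val.map (Function.update k s b) = b ::ₘ Finset.univ.val.map k := by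
  have hs : (Finset.univ : Finset (Fin N)).val = s ::ₘ (Finset.univ.erase s).val := by
    rw [← Finset.insert_val_of_notMem (Finset.notMem_erase s _),
      Finset.insert_erase (Finset.mem_univ s)]
  rw [hs, Multiset.map_cons, Multiset.map_cons, Function.update_self, Multiset.cons_swap]
  congr 2
  refine Multiset.map_congr rfl fun t ht => ?_
  rw [Function.update_of_ne]
  rintro rfl
  exact Finset.notMem_erase t Finset.univ (by simpa only [Finset.mem_val] using ht)

theorem dominated_update {N : ℕ} (k : Fin N → Index) (s : Fin N) (a b : Index)
    (hdeg : b.n + b.l ≤ a.n + a.l + ((k s).n + (k s).l)) (hm : b.m = a.m + (k s).m)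
    (hl : (b.l : ZMod 2) = a.l + (k s).l) :
    Dominated (a ::ₘ Finset.univ.val.map k) (Finset.univ.val.map (Function.update k s b)) := by
  have h := map_update_cons k s b
  have h1 := congrArg (fun μ => (μ.map fun a => a.n + a.l).sum) h
  have h2 := congrArg (fun μ => (μ.map Index.m).sum) h
  have h3 := congrArg (fun μ => (((μ.map Index.l).sum : ℕ) : ZMod 2)) h
  simp only [Multiset.map_cons, Multiset.sum_cons, Nat.cast_add] at h1 h2 h3
  simp only [Dominated, Multiset.map_cons, Multiset.sum_cons, Nat.cast_add]
  refine ⟨by omega, by omega, ?_⟩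
  rw [hl] at h3
  linear_combination h3

/-- Induction on the order by `distinctSum_cons`: the free term supplies the leading monomial, and
every collision term has one slot fewer. -/
theorem distinctSum_sub_mem_lowerSpan {rcut : ℝ} {R : ℕ → ℂ[X]} (hR : ∀ n, (R n).degree = n)
    (N : ℕ) (k : Fin N → Index) :
    distinctSum (Omega rcut) N (fun t => phi R (k t)) - pooledProd R (Finset.univ.val.map k) ∈
      lowerSpan R N (Finset.univ.val.map k) := by
  induction N with
  | zero =>
    convert Submodule.zero_mem _
    ext X
    simp [distinctSum_apply, pooledProd]
  | succ N ih =>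
    obtain ⟨a, k, rfl⟩ : ∃ a k', k = (Fin.cons a k' : Fin (N + 1) → Index) :=
      ⟨k 0, Fin.tail k, (Fin.cons_self_tail k).symm⟩
    have hμ : (Finset.univ.val.map (Fin.cons a k : Fin (N + 1) → Index)) =
        a ::ₘ Finset.univ.val.map k := by
      rw [Fin.univ_succ]
      simp [Function.comp_def]
    have hf : (fun t => phi R ((Fin.cons a k : Fin (N + 1) → Index) t) : _ → Omega rcut → ℂ) =
        Fin.cons (phi R a) (fun t => phi R (k t)) := by
      ext t : 1
      refine Fin.cases ?_ (fun t => ?_) t <;> simp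
    have hp : (fun X => (X.map (phi R a)).sum : Multiset (Omega rcut) → ℂ) = pooled R a := rfl
    rw [hμ, hf, distinctSum_cons, pooledProd_cons, hp, sub_right_comm, ← mul_sub]
    refine Submodule.sub_mem _ ?_ (Submodule.sum_mem _ fun s _ => ?_)
    · let T : (Multiset (Omega rcut) → ℂ) →ₗ[ℂ] (Multiset (Omega rcut) → ℂ) :=
        LinearMap.mulLeft ℂ (pooled R a)
      have hle : lowerSpan R N (Finset.univ.val.map k) ≤
          (lowerSpan R (N + 1) (a ::ₘ Finset.univ.val.map k)).comap T := by
        refine Submodule.span_le.2 ?_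
        rintro _ ⟨μ, hμ, rfl⟩
        refine Submodule.subset_span ⟨a ::ₘ μ, ⟨?_, hμ.2.cons a⟩, pooledProd_cons R a μ⟩
        rw [Multiset.card_cons]
        exact Nat.succ_lt_succ hμ.1
      exact hle (ih k)
    -- Linearity in slot `s` lets the expansion of the merged product be treated one basis function
    -- `phi R b` at a time.
    · let T := (distinctSum (Omega rcut) N).toLinearMap (fun t => phi R (k t)) s
      have hle : Submodule.span ℂ (phi R '' {c | c.n + c.l ≤
            a.n + a.l + ((k s).n + (k s).l) ∧ c.m = a.m + (k s).m ∧
              ∃ i, c.l + 2 * i = a.l + (k s).l}) ≤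
          (lowerSpan R (N + 1) (a ::ₘ Finset.univ.val.map k)).comap T := by
        refine Submodule.span_le.2 ?_
        rintro _ ⟨b, ⟨hb1, hb2, i, hb3⟩, rfl⟩
        have hl : (b.l : ZMod 2) = a.l + (k s).l := by
          have := congrArg (fun n : ℕ => (n : ZMod 2)) hb3
          have h2 : (2 : ZMod 2) = 0 := rfl
          push_cast at this
          rwa [h2, zero_mul, add_zero] at this
        have hdom := dominated_update k s a b hb1 hb2 hl
        have hT : T (phi R b) = distinctSum (Omega rcut) N
            (fun t => phi R (Function.update k s b t)) := by
          change distinctSum (Omega rcut) N (Function.update _ s _) = _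
          congr 1
          ext t : 1
          by_cases ht : t = s
          · subst ht; simp
          · simp [ht]
        change T (phi R b) ∈ lowerSpan R (N + 1) (a ::ₘ Finset.univ.val.map k)
        rw [hT, ← sub_add_cancel (distinctSum (Omega rcut) N _)
          (pooledProd R (Finset.univ.val.map (Function.update k s b)))]
        refine Submodule.add_mem _ (lowerSpan_mono (Nat.le_succ N) hdom (ih _)) ?_
        -- The leading monomial of a collision term has order `N`, hence is itself of lower order
        -- than `N + 1`.
        exact Submodule.subset_span ⟨_, ⟨by simp, hdom⟩, rfl⟩
      exact hle (phi_mul_phi_mem_span hR a (k s))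

/-! ### Linear independence of the one-particle functions -/

/-- In a vanishing combination of products, each fibre over an independent family vanishes. -/
theorem sum_fiber_eq_zero {K ι E : Type*} [DecidableEq ι] {f : ι → E → ℂ}
    (hf : LinearIndependent ℂ f) (s : Finset K) (p : K → ι) (b : K → ℂ)
    (h : ∀ x, ∑ k ∈ s, f (p k) x * b k = 0) (i : ι) : ∑ k ∈ s with p k = i, b k = 0 := by
  by_cases hi : i ∈ s.image p
  · refine linearIndependent_iff'.1 hf (s.image p) (fun i => ∑ k ∈ s with p k = i, b k) ?_ i hi
    ext x
    rw [Finset.sum_apply, Pi.zero_apply, ← h x,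
      ← Finset.sum_fiberwise_of_maps_to (fun k hk => Finset.mem_image_of_mem p hk)]
    refine Finset.sum_congr rfl fun i _ => ?_
    rw [Pi.smul_apply, smul_eq_mul, Finset.sum_mul]
    refine Finset.sum_congr rfl fun k hk => ?_
    rw [(Finset.mem_filter.1 hk).2, mul_comm]
  · rw [Finset.sum_eq_zero]
    intro k hk
    rw [Finset.mem_filter] at hk
    exact absurd (hk.2 ▸ Finset.mem_image_of_mem p hk.1) hi

/-- Polynomials of pairwise distinct degrees are independent as functions on an infinite set. -/
theorem linearIndependent_eval {ι E : Type*} {q : ι → ℂ[X]} (hq0 : ∀ i, q i ≠ 0)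
    (hq : Function.Injective fun i => (q i).natDegree) {z : E → ℂ} (hz : (Set.range z).Infinite) :
    LinearIndependent ℂ fun i (x : E) => (q i).eval (z x) := by
  have h1 : LinearIndependent ℂ q := by
    rw [linearIndependent_iff']
    intro s c hsum i hi
    by_contra hci
    have hne : ({i ∈ s | c i ≠ 0} : Finset ι).Nonempty := ⟨i, Finset.mem_filter.2 ⟨hi, hci⟩⟩
    obtain ⟨j, hj, hmax⟩ := Finset.exists_max_image _ (fun i => (q i).natDegree) hne
    rw [Finset.mem_filter] at hj
    have hcoeff := congrArg (fun p => p.coeff (q j).natDegree) hsum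
    simp only [Polynomial.finsetSum_coeff, Polynomial.coeff_smul, smul_eq_mul,
      Polynomial.coeff_zero] at hcoeff
    rw [Finset.sum_eq_single_of_mem j hj.1] at hcoeff
    · exact mul_ne_zero hj.2 (Polynomial.leadingCoeff_ne_zero.2 (hq0 j)) hcoeff
    · intro b hb hbj
      by_cases hcb : c b = 0
      · rw [hcb, zero_mul]
      · have hle := hmax b (Finset.mem_filter.2 ⟨hb, hcb⟩)
        rw [Polynomial.coeff_eq_zero_of_natDegree_lt (lt_of_le_of_ne hle fun h => hbj (hq h)),
          mul_zero]
  let ev : ℂ[X] →ₗ[ℂ] (E → ℂ) := LinearMap.pi fun x => Polynomial.leval (z x)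
  refine h1.map' ev (LinearMap.ker_eq_bot'.2 fun p hp => ?_)
  refine Polynomial.eq_zero_of_infinite_isRoot p (hz.mono ?_)
  rintro _ ⟨x, rfl⟩
  exact congrFun hp x

/-- These are distinct characters of the circle, so Dedekind's theorem applies. -/
theorem linearIndependent_circle_zpow :
    LinearIndependent ℂ fun (m : ℤ) (w : Circle) => (w : ℂ) ^ m := by
  let χ : ℤ → (Circle →* ℂ) := fun m => Circle.coeHom.comp (zpowGroupHom m)
  have hχ : Function.Injective χ := by
    intro m m' h
    -- The point `exp(i)` has infinite order: otherwise a nonzero integer would be a multiple of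
    -- `2π`, making `π` rational.
    have h1 := DFunLike.congr_fun h (Circle.exp 1)
    have h2 : (Circle.exp 1) ^ m = (Circle.exp 1) ^ m' := Circle.coe_injective h1
    by_contra hne
    have h3 : (Circle.exp 1) ^ (m - m') = 1 := by rw [zpow_sub, h2, mul_inv_cancel]
    rw [← Circle.exp_zsmul, Circle.exp_eq_one] at h3
    obtain ⟨n, hn⟩ := h3
    simp only [zsmul_eq_mul, mul_one] at hn
    have hn0 : n ≠ 0 := by
      rintro rfl
      simp only [Int.cast_zero, zero_mul] at hn
      exact hne (sub_eq_zero.1 (by exact_mod_cast hn))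
    refine irrational_pi ⟨((m - m' : ℤ) : ℚ) / (2 * n), ?_⟩
    have : (n : ℝ) ≠ 0 := Int.cast_ne_zero.2 hn0
    push_cast at hn ⊢
    field_simp
    linarith
  have hfun : (fun (m : ℤ) (w : Circle) => (w : ℂ) ^ m) = fun m => (χ m : Circle → ℂ) := by
    funext m w
    exact (Circle.coe_zpow w m).symm
  rw [hfun]
  exact (linearIndependent_monoidHom Circle ℂ).comp χ hχ

/-- The unit vector of height `z` and azimuthal phase `w`. -/
def spherePoint (z : Set.Ioo (-1 : ℝ) 1) (w : Circle) : Sphere2 :=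
  ⟨!₂[√(1 - z.1 ^ 2) * (w : ℂ).re, √(1 - z.1 ^ 2) * (w : ℂ).im, z.1], by
    have h1 : (0 : ℝ) ≤ 1 - z.1 ^ 2 := by nlinarith [z.2.1, z.2.2]
    have h2 : (w : ℂ).re ^ 2 + (w : ℂ).im ^ 2 = 1 := by
      have := Circle.normSq_coe w
      rw [Complex.normSq_apply] at this
      linarith
    rw [mem_sphere_zero_iff_norm, ← sq_eq_sq₀ (norm_nonneg _) zero_le_one,
      EuclideanSpace.real_norm_sq_eq, Fin.sum_univ_three]
    simp only [Matrix.cons_val_zero, Matrix.cons_val_one, Matrix.cons_val]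
    rw [mul_pow, mul_pow, Real.sq_sqrt h1]
    linear_combination (1 - z.1 ^ 2) * h2⟩

theorem azimuth_spherePoint (m : ℤ) (z : Set.Ioo (-1 : ℝ) 1) (w : Circle) :
    azimuth m (spherePoint z w) = (w : ℂ) ^ m * ((√(1 - z.1 ^ 2) : ℝ) : ℂ) ^ m.natAbs := by
  have h1 : (((spherePoint z w).1 0 : ℝ) : ℂ) + Complex.I * (((spherePoint z w).1 1 : ℝ) : ℂ) =
      ((√(1 - z.1 ^ 2) : ℝ) : ℂ) * w := by
    have hw := Complex.re_add_im (w : ℂ)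
    simp only [spherePoint, Matrix.cons_val_zero, Matrix.cons_val_one, Complex.ofReal_mul]
    linear_combination ((√(1 - z.1 ^ 2) : ℝ) : ℂ) * hw
  have h2 : (((spherePoint z w).1 0 : ℝ) : ℂ) - Complex.I * (((spherePoint z w).1 1 : ℝ) : ℂ) =
      ((√(1 - z.1 ^ 2) : ℝ) : ℂ) * (w : ℂ)⁻¹ := by
    rw [← Circle.coe_inv, Circle.coe_inv_eq_conj]
    have hw : (starRingEnd ℂ) (w : ℂ) = ((w : ℂ).re : ℂ) - ((w : ℂ).im : ℂ) * Complex.I := by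
      apply Complex.ext <;> simp
    simp only [spherePoint, Matrix.cons_val_zero, Matrix.cons_val_one, Complex.ofReal_mul]
    linear_combination -((√(1 - z.1 ^ 2) : ℝ) : ℂ) * hw
  rw [azimuth, h1, h2]
  rcases le_total 0 m with h | h
  · lift m to ℕ using h
    simp [mul_pow, mul_comm]
  · obtain ⟨n, rfl⟩ : ∃ n : ℕ, m = -n := ⟨m.natAbs, by omega⟩
    simp [mul_pow, mul_comm]

/-- Separation of variables: independence in the radius isolates `n`, in the azimuthal phase `m`,
and in the height `l`. -/
theorem linearIndependent_phi {rcut : ℝ} (hrcut : 0 < rcut) {R : ℕ → ℂ[X]}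
    (hR : ∀ n, (R n).degree = n) :
    LinearIndependent ℂ fun k : Index => (phi R k : Omega rcut → ℂ) := by
  classical
  have hrad : LinearIndependent ℂ fun (n : ℕ) (r : Set.Icc (0 : ℝ) rcut) =>
      (R n).eval ((r : ℝ) : ℂ) := by
    refine linearIndependent_eval (fun n h => ?_) (fun n n' h => ?_) ?_
    · have := hR n
      rw [h, Polynomial.degree_zero] at this
      exact absurd this (by simp)
    · simpa only [Polynomial.natDegree_eq_of_degree_eq_some (hR _)] using h
    · have : Infinite (Set.Icc (0 : ℝ) rcut) := (Set.Icc_infinite hrcut).to_subtype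
      exact Set.infinite_range_of_injective (Complex.ofReal_injective.comp Subtype.val_injective)
  have hpol : ∀ m : ℤ, LinearIndependent ℂ fun (l : {l : ℕ // m.natAbs ≤ l})
      (z : Set.Ioo (-1 : ℝ) 1) => (polarPoly l.1 m).eval ((z : ℝ) : ℂ) := by
    intro m
    have hdeg : ∀ l : {l : ℕ // m.natAbs ≤ l},
        (polarPoly l.1 m).natDegree = l.1 - m.natAbs := by
      intro l
      refine le_antisymm (Polynomial.natDegree_le_iff_coeff_eq_zero.2 fun j hj => ?_)
        (Polynomial.le_natDegree_of_ne_zero (coeff_polarPoly_ne_zero (Nat.sub_add_cancel l.2)))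
      by_contra h
      obtain ⟨i, hi⟩ := coeff_polarPoly_ne_zero_imp h
      omega
    refine linearIndependent_eval (fun l h => ?_) (fun l l' h => ?_) ?_
    · refine coeff_polarPoly_ne_zero (Nat.sub_add_cancel l.2) ?_
      rw [h, Polynomial.coeff_zero]
    · simp only [hdeg] at h
      exact Subtype.ext (by have := l.2; have := l'.2; omega)
    · have : Infinite (Set.Ioo (-1 : ℝ) 1) := (Set.Ioo_infinite (by norm_num)).to_subtype
      exact Set.infinite_range_of_injective (Complex.ofReal_injective.comp Subtype.val_injective)
  rw [linearIndependent_iff']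
  intro s c hsum k₀ hk₀
  have h1 : ∀ u : Sphere2, ∑ k ∈ s with k.n = k₀.n, c k * sphHarm k.l k.m u = 0 := fun u => by
    refine sum_fiber_eq_zero hrad s Index.n (fun k => c k * sphHarm k.l k.m u) (fun r => ?_) k₀.n
    have := congrFun hsum (r, u)
    rw [Finset.sum_apply, Pi.zero_apply] at this
    rw [← this]
    refine Finset.sum_congr rfl fun k _ => ?_
    rw [Pi.smul_apply, smul_eq_mul, phi]
    ring
  have h2 : ∀ z : Set.Ioo (-1 : ℝ) 1,
      ∑ k ∈ {k ∈ s | k.n = k₀.n} with k.m = k₀.m,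
        c k * (polarPoly k.l k.m).eval ((z : ℝ) : ℂ) = 0 := fun z => by
    -- The poles are excluded so that the common factor `(1 - z²)^{|m|/2}` can be divided out.
    have hz : ((√(1 - z.1 ^ 2) : ℝ) : ℂ) ≠ 0 := by
      rw [Complex.ofReal_ne_zero]
      exact (Real.sqrt_pos.2 (by nlinarith [z.2.1, z.2.2])).ne'
    have h := sum_fiber_eq_zero linearIndependent_circle_zpow {k ∈ s | k.n = k₀.n} Index.m
      (fun k => c k * (polarPoly k.l k.m).eval ((z : ℝ) : ℂ) *
        ((√(1 - z.1 ^ 2) : ℝ) : ℂ) ^ k.m.natAbs) (fun w => by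
        rw [← h1 (spherePoint z w)]
        refine Finset.sum_congr rfl fun k _ => ?_
        rw [sphHarm_eq, azimuth_spherePoint]
        change _ = c k * ((polarPoly k.l k.m).eval ((z : ℝ) : ℂ) * _)
        ring) k₀.m
    rw [← mul_left_inj' (pow_ne_zero k₀.m.natAbs hz), zero_mul, ← h, Finset.sum_mul]
    refine Finset.sum_congr rfl fun k hk => ?_
    rw [(Finset.mem_filter.1 hk).2]
  have hk₀' : ∀ k : Index, k.m.natAbs ≤ k.l := fun k => by
    have := abs_le.1 k.abs_le
    omega
  have h3 := sum_fiber_eq_zero (hpol k₀.m)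
    ({k ∈ {k ∈ s | k.n = k₀.n} | k.m = k₀.m} : Finset Index)
    -- The default branch is never reached: the indices left have `k.m = k₀.m`, hence `|k₀.m| ≤
    -- k.l`.
    (fun k => if h : k₀.m.natAbs ≤ k.l then ⟨k.l, h⟩ else ⟨_, le_rfl⟩) c (fun z => by
      rw [← h2 z]
      refine Finset.sum_congr rfl fun k hk => ?_
      have hm := (Finset.mem_filter.1 hk).2
      have := hk₀' k
      rw [hm] at this
      rw [dif_pos this, hm, mul_comm]) ⟨k₀.l, hk₀' k₀⟩
  rw [← h3, Finset.sum_eq_single_of_mem k₀]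
  · simp only [Finset.mem_filter, and_true, hk₀, true_and]
    rw [dif_pos (hk₀' k₀)]
  · intro k hk hne
    simp only [Finset.mem_filter] at hk
    obtain ⟨⟨⟨-, hn⟩, hm⟩, hl⟩ := hk
    have := hk₀' k
    rw [hm] at this
    rw [dif_pos this, Subtype.mk.injEq] at hl
    exact absurd (Index.ext hn hl hm) hne

/-! ### Linear independence of the self-interacting functions -/

/-- A polynomial vanishing on the sums of one-particle vectors over all multisets is zero. -/
theorem mvPolynomial_eq_zero_of_sums {σ E : Type*} [Finite σ] {f : σ → E → ℂ}
    (hf : LinearIndependent ℂ f) (p : MvPolynomial σ ℂ)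
    (h : ∀ X : Multiset E, MvPolynomial.eval (fun i => (X.map (f i)).sum) p = 0) : p = 0 := by
  classical
  have := Fintype.ofFinite σ
  let T : (E →₀ ℂ) →ₗ[ℂ] (σ → ℂ) := Finsupp.linearCombination ℂ fun x i => f i x
  -- A nonzero functional vanishing on all one-particle vectors would be a linear relation among the
  -- `f i`.
  have hT : LinearMap.range T = ⊤ := by
    by_contra hne
    obtain ⟨g, hg0, hg⟩ := Submodule.exists_le_ker_of_lt_top _ (lt_top_iff_ne_top.2 hne)
    have hgf : ∑ i, g (Pi.single i 1) • f i = 0 := by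
      ext x
      have hx : T (Finsupp.single x 1) = fun i => f i x := by simp [T]
      have h0 : g (fun i => f i x) = 0 := hg ⟨_, hx⟩
      refine Eq.trans ?_ h0
      rw [Finset.sum_apply, LinearMap.pi_apply_eq_sum_univ g]
      refine Finset.sum_congr rfl fun i _ => ?_
      rw [Pi.smul_apply, smul_eq_mul, smul_eq_mul, mul_comm]
      congr 2
      ext j
      simp [Pi.single_apply, eq_comm]
    refine hg0 (LinearMap.pi_ext' fun i => LinearMap.ext_ring ?_)
    simpa using Fintype.linearIndependent_iff.1 hf _ hgf i
  refine MvPolynomial.funext fun w => ?_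
  obtain ⟨v, rfl⟩ : w ∈ LinearMap.range T := hT ▸ Submodule.mem_top
  -- Here `p` becomes a polynomial in the weights of finitely many particles. Natural number weights
  -- are multiplicities in a multiset, so `P` vanishes on a grid of naturals, hence identically, and
  -- in particular at the complex weights `v`.
  let P : MvPolynomial v.support ℂ :=
    MvPolynomial.bind₁ (fun i => ∑ x : v.support, MvPolynomial.C (f i x) * MvPolynomial.X x) p
  have hP : ∀ y : v.support → ℂ, MvPolynomial.eval y P =
      MvPolynomial.eval (fun i => ∑ x : v.support, f i x * y x) p := by
    intro y
    have hb := MvPolynomial.aeval_bind₁ (R := ℂ) y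
      (fun i => ∑ x : v.support, MvPolynomial.C (f i x) * MvPolynomial.X x) p
    simpa [MvPolynomial.aeval_eq_eval, P] using hb
  have hP0 : P = 0 := by
    refine MvPolynomial.funext_set (fun _ => Set.range ((↑) : ℕ → ℂ))
      (fun _ => Set.infinite_range_of_injective Nat.cast_injective) fun y hy => ?_
    choose n hn using fun x => hy x trivial
    rw [hP, map_zero, ← h (∑ x : v.support, n x • {x.1})]
    congr 2
    ext i
    have hmap := map_sum ((Multiset.sumAddMonoidHom (M := ℂ)).comp (Multiset.mapAddMonoidHom (f i)))
      (fun x : v.support => n x • ({x.1} : Multiset E)) Finset.univ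
    refine Eq.trans ?_ hmap.symm
    refine Finset.sum_congr rfl fun x _ => ?_
    rw [map_nsmul, nsmul_eq_mul, hn, mul_comm]
    simp
  have := hP (fun x => v x)
  rw [hP0, map_zero] at this
  rw [map_zero, this]
  congr 2
  ext i
  simp only [T, Finsupp.linearCombination_apply, Finsupp.sum, Finset.sum_apply, Pi.smul_apply,
    smul_eq_mul]
  rw [← Finset.sum_coe_sort]
  exact Finset.sum_congr rfl fun x _ => mul_comm _ _

theorem linearIndependent_pooledProd {rcut : ℝ} (hrcut : 0 < rcut) {R : ℕ → ℂ[X]}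
    (hR : ∀ n, (R n).degree = n) :
    LinearIndependent ℂ fun μ : Multiset Index =>
      (pooledProd R μ : Multiset (Omega rcut) → ℂ) := by
  classical
  have hA : AlgebraicIndependent ℂ fun k : Index =>
      (pooled R k : Multiset (Omega rcut) → ℂ) := by
    rw [algebraicIndependent_iff]
    intro p hp
    obtain ⟨t, q, rfl⟩ := MvPolynomial.exists_finset_rename p
    have hq : q = 0 := by
      refine mvPolynomial_eq_zero_of_sums
        ((linearIndependent_phi hrcut hR).comp ((↑) : t → Index) Subtype.val_injective) q
        fun X => ?_
      have hX := congrArg (Pi.evalAlgHom ℂ (fun _ : Multiset (Omega rcut) => ℂ) X) hp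
      rw [MvPolynomial.aeval_rename, map_zero, ← AlgHom.comp_apply,
        MvPolynomial.comp_aeval] at hX
      rw [← MvPolynomial.coe_aeval_eq_eval]
      exact hX
    rw [hq, map_zero]
  have hmon : LinearIndependent ℂ fun μ : Multiset Index =>
      (MvPolynomial.monomial (Multiset.toFinsupp μ) 1 : MvPolynomial Index ℂ) :=
    (MvPolynomial.basisMonomials Index ℂ).linearIndependent.comp _
      Multiset.toFinsupp.injective
  have h := hmon.map' (MvPolynomial.aeval fun k : Index =>
      (pooled R k : Multiset (Omega rcut) → ℂ)).toLinearMap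
    (LinearMap.ker_eq_bot.2 hA)
  have hfun : (fun μ : Multiset Index => (pooledProd R μ : Multiset (Omega rcut) → ℂ)) =
      fun μ => MvPolynomial.aeval (fun k : Index => (pooled R k : Multiset (Omega rcut) → ℂ))
        (MvPolynomial.monomial (Multiset.toFinsupp μ) (1 : ℂ)) := by
    ext μ : 1
    rw [MvPolynomial.aeval_monomial, map_one, one_mul, pooledProd, Finset.prod_multiset_map_count]
    rfl
  rw [hfun]
  exact h

/-! ### Ordered tuples -/

theorem canonical_eq_distinctSum {rcut : ℝ} (R : ℕ → ℂ[X]) (k : List Index) :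
    (canonical R k : Multiset (Omega rcut) → ℂ) =
      distinctSum (Omega rcut) k.length fun t => phi R (k.get t) := by
  ext X
  rw [distinctSum_apply, canonical]

theorem selfInteracting_eq_pooledProd {rcut : ℝ} (R : ℕ → ℂ[X]) (k : List Index) :
    (selfInteracting R k : Multiset (Omega rcut) → ℂ) = pooledProd R (k : Multiset Index) := by
  induction k with
  | nil => rfl
  | cons a k ih =>
    rw [← Multiset.cons_coe, pooledProd_cons, ← ih]
    ext X
    simp [selfInteracting]

theorem sort_mem_indexSet [LinearOrder Index] {D maxOrd : ℕ} {k : List Index}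
    (hk : k ∈ indexSet D maxOrd) {μ : Multiset Index} (hcard : μ.card < k.length)
    (hμ : Dominated (k : Multiset Index) μ) : μ.sort ∈ indexSet D maxOrd := by
  obtain ⟨-, hlen, hdeg, hm, hl⟩ := hk
  obtain ⟨h1, h2, h3⟩ := hμ
  rw [← ZMod.natCast_eq_zero_iff_even] at hl
  have hsort : ∀ {M : Type} [AddCommMonoid M] (g : Index → M),
      (μ.sort.map g).sum = (μ.map g).sum := fun g => by
    conv_rhs => rw [← Multiset.sort_eq μ (· ≤ ·)]
    rw [Multiset.map_coe, Multiset.sum_coe]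
  simp only [Multiset.map_coe, Multiset.sum_coe] at h1 h2 h3
  refine ⟨Multiset.pairwise_sort _ _, ?_, ?_, ?_, ?_⟩
  · rw [Multiset.length_sort]
    exact hcard.le.trans hlen
  · rw [deg, hsort]
    exact h1.trans hdeg
  · rw [hsort, h2, hm]
  · rw [hsort, ← ZMod.natCast_eq_zero_iff_even, h3, hl]

theorem canonical_sub_selfInteracting_mem_span [LinearOrder Index] {rcut : ℝ} {R : ℕ → ℂ[X]}
    (hR : ∀ n, (R n).degree = n) {D maxOrd : ℕ} (k : indexSet D maxOrd) :
    (canonical R k.1 - selfInteracting R k.1 : Multiset (Omega rcut) → ℂ) ∈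
      Submodule.span ℂ ((fun k' : indexSet D maxOrd => selfInteracting R k'.1) ''
        {k' | k'.1.length < k.1.length}) := by
  have hk : Finset.univ.val.map k.1.get = (k.1 : Multiset Index) := by
    rw [Fin.univ_val_map, List.ofFn_get]
  have h := distinctSum_sub_mem_lowerSpan (rcut := rcut) hR k.1.length k.1.get
  rw [hk, ← canonical_eq_distinctSum, ← selfInteracting_eq_pooledProd] at h
  refine Submodule.span_mono ?_ h
  rintro _ ⟨μ, ⟨hcard, hμ⟩, rfl⟩
  refine ⟨⟨μ.sort, sort_mem_indexSet k.2 hcard hμ⟩, ?_, ?_⟩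
  · change μ.sort.length < _
    rwa [Multiset.length_sort]
  · change selfInteracting R μ.sort = _
    rw [selfInteracting_eq_pooledProd, Multiset.sort_eq]

theorem canonical_mem_span [LinearOrder Index] {rcut : ℝ} {R : ℕ → ℂ[X]}
    (hR : ∀ n, (R n).degree = n) {D maxOrd : ℕ} (k : indexSet D maxOrd) :
    (canonical R k.1 : Multiset (Omega rcut) → ℂ) ∈
      Submodule.span ℂ (Set.range fun k' : indexSet D maxOrd => selfInteracting R k'.1) := by
  rw [← sub_add_cancel (canonical R k.1) (selfInteracting R k.1)]
  exact Submodule.add_mem _ (Submodule.span_mono (Set.image_subset_range _ _)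
    (canonical_sub_selfInteracting_mem_span hR k)) (Submodule.subset_span ⟨k, rfl⟩)

/-- Back substitution in the unitriangular system, by strong induction on the tuple length. -/
theorem selfInteracting_mem_span [LinearOrder Index] {rcut : ℝ} {R : ℕ → ℂ[X]}
    (hR : ∀ n, (R n).degree = n) {D maxOrd : ℕ} (k : indexSet D maxOrd) :
    (selfInteracting R k.1 : Multiset (Omega rcut) → ℂ) ∈
      Submodule.span ℂ (Set.range fun k' : indexSet D maxOrd => canonical R k'.1) := by
  induction hN : k.1.length using Nat.strong_induction_on generalizing k with
  | _ N ih =>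
    rw [← sub_sub_cancel (canonical R k.1) (selfInteracting R k.1)]
    refine Submodule.sub_mem _ (Submodule.subset_span ⟨k, rfl⟩)
      (Submodule.span_le.2 ?_ (canonical_sub_selfInteracting_mem_span hR k))
    rintro _ ⟨k', hk', rfl⟩
    exact ih _ (hN ▸ hk') k' rfl

/-- Ordering makes a tuple recoverable from its multiset, so distinct tuples give distinct
monomials. -/
theorem linearIndependent_selfInteracting [LinearOrder Index] {rcut : ℝ} (hrcut : 0 < rcut)
    {R : ℕ → ℂ[X]} (hR : ∀ n, (R n).degree = n) (D maxOrd : ℕ) :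
    LinearIndependent ℂ fun k : indexSet D maxOrd =>
      (selfInteracting R k.1 : Multiset (Omega rcut) → ℂ) := by
  have hinj : Function.Injective fun k : indexSet D maxOrd => (k.1 : Multiset Index) :=
    fun k k' h => Subtype.ext
      ((Multiset.coe_eq_coe.1 h).eq_of_pairwise' (r := (· ≤ ·)) k.2.1 k'.2.1)
  simp only [selfInteracting_eq_pooledProd]
  exact (linearIndependent_pooledProd hrcut hR).comp _ hinj

/-- Two finite families, the second of them independent, that span each other are related by a
unique matrix, which is invertible. -/
theorem exists_unique_isUnit_matrix {K V : Type*} [Fintype K] [DecidableEq K] [AddCommGroup V]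
    [Module ℂ V] {C S : K → V} (hS : LinearIndependent ℂ S)
    (hCS : ∀ k, C k ∈ Submodule.span ℂ (Set.range S))
    (hSC : ∀ k, S k ∈ Submodule.span ℂ (Set.range C)) :
    ∃ P : Matrix K K ℂ, IsUnit P ∧ (∀ k, C k = ∑ k', P k k' • S k') ∧
      ∀ k (c : K → ℂ), C k = ∑ k', c k' • S k' → c = P k := by
  simp only [Submodule.mem_span_range_iff_exists_fun] at hCS hSC
  choose P hP using hCS
  choose Q hQ using hSC
  have huniq : ∀ c d : K → ℂ, ∑ k', c k' • S k' = ∑ k', d k' • S k' → c = d := fun c d h =>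
    funext (Fintype.linearIndependent_iffₛ.1 hS c d h)
  refine ⟨Matrix.of P, IsUnit.of_mul_eq_one_right (Matrix.of Q) ?_, fun k => (hP k).symm,
    fun k c hc => huniq c (P k) (hc.symm.trans (hP k).symm)⟩
  -- Row `k` of `Q * P` and row `k` of the identity both give coefficients of `S k` in the
  -- independent family `S`.
  refine funext fun k => huniq _ _ ?_
  have h1 : ∑ k', (1 : Matrix K K ℂ) k k' • S k' = S k := by simp [Matrix.one_apply]
  rw [h1, ← hQ k]
  simp only [Matrix.mul_apply, Matrix.of_apply, Finset.sum_smul, mul_smul]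
  rw [Finset.sum_comm]
  refine Finset.sum_congr rfl fun j _ => ?_
  rw [← Finset.smul_sum, hP]

end Purification

end

open Purification in
theorem proposition2p8 (rcut : ℝ) (hrcut : 0 < rcut)
    (R : ℕ → Polynomial ℂ) (hR : ∀ n, (R n).degree = n)
    [LinearOrder Index] (D maxOrd : ℕ) :
    (∀ k : indexSet D maxOrd, ∃! c : indexSet D maxOrd → ℂ,
      ∀ X : Multiset (Omega rcut),
        canonical R k.1 X = ∑ k', c k' * selfInteracting R k'.1 X) ∧
    ∃ P : Matrix (indexSet D maxOrd) (indexSet D maxOrd) ℂ,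
      IsUnit P ∧
      (∀ k, ∀ X : Multiset (Omega rcut),
        canonical R k.1 X = ∑ k', P k k' * selfInteracting R k'.1 X) ∧
      ∀ Q : Matrix (indexSet D maxOrd) (indexSet D maxOrd) ℂ,
        (∀ k, ∀ X : Multiset (Omega rcut),
          canonical R k.1 X = ∑ k', Q k k' * selfInteracting R k'.1 X) → Q = P := by
  have hfun : ∀ (k : indexSet D maxOrd) (c : indexSet D maxOrd → ℂ),
      (canonical R k.1 : Multiset (Omega rcut) → ℂ) = ∑ k', c k' • selfInteracting R k'.1 ↔
      ∀ X : Multiset (Omega rcut),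
        canonical R k.1 X = ∑ k', c k' * selfInteracting R k'.1 X := fun k c => by
    simp [funext_iff]
  obtain ⟨P, hunit, hP, huniq⟩ := exists_unique_isUnit_matrix
    (linearIndependent_selfInteracting hrcut hR D maxOrd)
    (canonical_mem_span hR) (selfInteracting_mem_span hR)
  exact ⟨fun k => ⟨P k, (hfun k _).1 (hP k), fun c hc => huniq k c ((hfun k c).2 hc)⟩,
    P, by convert hunit, fun k => (hfun k _).1 (hP k),
    fun Q hQ => funext fun k => huniq k (Q k) ((hfun k _).2 (hQ k))⟩
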